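/- A \emph{semilattice} is a partially ordered set $S$ in which any two elements $x,y$ have a supremum $x\oplus y$. A subset $C\subseteq S$ is \emph{convex} if $x\oplus y\in C$ for all $x,y\in C$ (the empty set is convex), and the \emph{convex hull} $\mathrm{co}(A)$ of $A\subseteq S$ is the smallest convex subset containing $A$. An \emph{extreme point} of $A$ is an element $x\in A$ with $x\notin \mathrm{co}(A\setminus\{x\})$; the set of extreme points of $A$ is denoted by $\mathrm{ex}\,A$. A \emph{topological semilattice} is a semilattice with a Hausdorff topology for which $(x,y)\mapsto x\oplus y$ is (jointly) continuous; it is \emph{locally convex} if every point has a basis of (not necessarily open) convex neighbourhoods. A subset $K\subseteq S$ is \emph{principally compact} if $K\cap{\downarrow}x$ is compact for all $x\in K$, where ${\downarrow}x=\{y\in S: y\le x\}$. \textbf{Theorem.} Let $S$ be a locally convex topological semilattice. \begin{enumerate} \item Every nonempty compact subset of $S$ has at least one extreme point. \item Every compact convex subset $K$ of $S$ is the closed convex hull of its extreme points: $K=\overline{\mathrm{co}(\mathrm{ex}\,K)}$. \item Every nonempty principally compact subset of $S$ has at least one extreme point. \item Every principally compact closed convex subset $K$ of $S$ is the closed convex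 hull of its extreme points: $K=\overline{\mathrm{co}(\mathrm{ex}\,K)}$. \end{enumerate} -/

import Mathlib

open Topology

namespace SemilatticeConvexity

/-- The convex subsets of a join-semilattice are its subsemilattices (`SupClosed`, the empty set
included), and the convex hull of `A` is the subsemilattice `supClosure A` generated by `A`.
`IsExtremePt A x`: `x` is an extreme point of `A`, i.e. a point of `A` that does not lie in the
convex hull of `A \ {x}`. -/
def IsExtremePt {S : Type*} [SemilatticeSup S] (A : Set S) (x : S) : Prop :=
  x ∈ A ∧ x ∉ supClosure (A \ {x})

/-- The set of extreme points of `A`. -/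
def ex {S : Type*} [SemilatticeSup S] (A : Set S) : Set S :=
  {x | IsExtremePt A x}

/-- Every point has a basis of (not necessarily open) convex neighbourhoods. -/
def LocallyConvex (S : Type*) [SemilatticeSup S] [TopologicalSpace S] : Prop :=
  ∀ x : S, (𝓝 x).HasBasis (fun U : Set S => U ∈ 𝓝 x ∧ SupClosed U) id

/-- `K ∩ ↓x` is compact for all `x ∈ K`. -/
def PrincipallyCompact {S : Type*} [SemilatticeSup S] [TopologicalSpace S] (K : Set S) : Prop :=
  ∀ x ∈ K, IsCompact (K ∩ Set.Iic x)

end SemilatticeConvexity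

namespace SemilatticeConvexity

open Set

/-! The order is closed, so nonempty compact sets have minimal elements, and these are extreme. For
the hull statements, replace `K` by `K ∩ Iic x`, whose extreme points are extreme in `K`; now `K` is
compact with top `x`. The closed hull of `ex K` has a greatest element `z`. If `x ≰ z`, some
relatively open ideal `V` contains `z` but not `x` (`exists_open_ideal`). A minimal point of `K \ V`
is extreme and not below `z`, a contradiction; hence `x = z`. -/

/-- A nonempty directed subset of a compact set has an upper bound in that set. -/
lemma exists_mem_upperBounds_of_directedOn {α : Type*} [TopologicalSpace α] [Preorder α]
    [ClosedIciTopology α] {K D : Set α} (hK : IsCompact K) (hDK : D ⊆ K) (hD : D.Nonempty)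
    (hdir : DirectedOn (· ≤ ·) D) : ∃ a ∈ K, a ∈ upperBounds D := by
  have : Nonempty D := hD.to_subtype
  obtain ⟨a, haK, ha⟩ := hK.inter_iInter_nonempty (fun d : D => Ici (d : α))
    (fun _ => isClosed_Ici) fun u => by
      obtain ⟨m, hm⟩ := hdir.directed_val.finset_le u
      exact ⟨m, hDK m.2, mem_iInter₂.2 hm⟩
  exact ⟨a, haK, fun d hd => mem_iInter.1 ha ⟨d, hd⟩⟩

lemma exists_maximal_of_isCompact {α : Type*} [TopologicalSpace α] [PartialOrder α]
    [ClosedIciTopology α] {K : Set α} (hK : IsCompact K) (hne : K.Nonempty) :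
    ∃ m, Maximal (· ∈ K) m := by
  obtain ⟨x, hx⟩ := hne
  obtain ⟨m, -, hm⟩ := zorn_le_nonempty₀ K (fun c hcK hc y hy =>
    exists_mem_upperBounds_of_directedOn hK hcK ⟨y, hy⟩ hc.directedOn) x hx
  exact ⟨m, hm⟩

lemma exists_minimal_of_isCompact {α : Type*} [TopologicalSpace α] [PartialOrder α]
    [ClosedIicTopology α] {K : Set α} (hK : IsCompact K) (hne : K.Nonempty) :
    ∃ m, Minimal (· ∈ K) m :=
  exists_maximal_of_isCompact (α := αᵒᵈ) hK hne

/-- A point `x` of `A` is extreme if a convex set contains all points of `A` strictly below `x`,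
but not `x` itself. -/
lemma isExtremePt_of_forall_lt {S : Type*} [SemilatticeSup S] {A V : Set S} {x : S}
    (hV : SupClosed V) (hxA : x ∈ A) (hxV : x ∉ V) (h : ∀ y ∈ A, y < x → y ∈ V) :
    IsExtremePt A x := by
  refine ⟨hxA, fun hx => ?_⟩
  -- The right-hand set is sup-closed because both terms of a join below `x` are themselves below
  -- `x`.
  have hsub : supClosure (A \ {x}) ⊆ {y | y ≤ x → y ∈ V} := by
    refine supClosure_min (fun y hy hyx => h y hy.1 (lt_of_le_of_ne hyx hy.2)) ?_
    intro a ha b hb hab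
    exact hV (ha (le_sup_left.trans hab)) (hb (le_sup_right.trans hab))
  exact hxV (hsub hx le_rfl)

lemma isExtremePt_of_minimal {S : Type*} [SemilatticeSup S] {A : Set S} {x : S}
    (hx : Minimal (· ∈ A) x) : IsExtremePt A x :=
  isExtremePt_of_forall_lt supClosed_empty hx.prop (notMem_empty x)
    fun _ hy hlt => (hx.not_lt hy hlt).elim

/-- Extreme points of a lower section of `A` are extreme points of `A`. -/
lemma IsExtremePt.of_inter_Iic {S : Type*} [SemilatticeSup S] {A : Set S} {x y : S}
    (hy : IsExtremePt (A ∩ Iic x) y) : IsExtremePt A y := by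
  refine isExtremePt_of_forall_lt supClosed_supClosure hy.1.1 hy.2 fun z hz hzy => ?_
  exact subset_supClosure ⟨⟨hz, hzy.le.trans hy.1.2⟩, hzy.ne⟩

section Topological

variable {S : Type*} [SemilatticeSup S] [TopologicalSpace S] [ContinuousSup S]

lemma supClosed_closure {A : Set S} (hA : SupClosed A) : SupClosed (closure A) :=
  fun _ ha _ hb => map_mem_closure₂ continuous_sup ha hb fun _ ha _ hb => hA ha hb

variable [T2Space S]

lemma orderClosedTopology_of_continuousSup : OrderClosedTopology S where
  isClosed_le' := by
    simp_rw [← sup_eq_right]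
    exact isClosed_eq continuous_sup continuous_snd

lemma exists_isGreatest_of_isCompact {K : Set S} (hK : IsCompact K) (hsup : SupClosed K)
    (hne : K.Nonempty) : ∃ a, IsGreatest K a := by
  have := orderClosedTopology_of_continuousSup (S := S)
  exact exists_mem_upperBounds_of_directedOn hK subset_rfl hne hsup.directedOn

lemma ex_nonempty_of_isCompact {K : Set S} (hK : IsCompact K) (hne : K.Nonempty) :
    (ex K).Nonempty := by
  have := orderClosedTopology_of_continuousSup (S := S)
  obtain ⟨m, hm⟩ := exists_minimal_of_isCompact hK hne
  exact ⟨m, isExtremePt_of_minimal hm⟩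

lemma ex_nonempty_of_principallyCompact {K : Set S} (hK : PrincipallyCompact K)
    (hne : K.Nonempty) : (ex K).Nonempty := by
  obtain ⟨x, hx⟩ := hne
  obtain ⟨y, hy⟩ := ex_nonempty_of_isCompact (hK x hx) ⟨x, hx, le_rfl⟩
  exact ⟨y, hy.of_inter_Iic⟩

/-- In a compact convex set, a point `z` with `¬ x ≤ z` has a principal ideal as a neighbourhood
whose top does not dominate `x` either. -/
lemma LocallyConvex.exists_Iic_mem_nhdsWithin (hS : LocallyConvex S) {K : Set S}
    (hK : IsCompact K) (hsup : SupClosed K) {x z : S} (hz : z ∈ K) (hxz : ¬ x ≤ z) :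
    ∃ a ∈ K, z ≤ a ∧ ¬ x ≤ a ∧ Iic a ∈ 𝓝[K] z := by
  have := orderClosedTopology_of_continuousSup (S := S)
  obtain ⟨U, V, hU, hV, hzU, hKV, hUV⟩ := SeparatedNhds.of_isCompact_isCompact
    (isCompact_singleton (x := z)) (hK.inter_right (isClosed_Ici (a := x)))
    (disjoint_singleton_left.2 fun h => hxz h.2)
  obtain ⟨W, ⟨hWz, hWsup⟩, hWU⟩ :=
    (hS z).mem_iff.1 (hU.mem_nhds (singleton_subset_iff.1 hzU))
  have hzW : z ∈ K ∩ W := ⟨hz, mem_of_mem_nhds hWz⟩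
  -- `W` need not be closed, so the top `a` is taken in the closure, which still avoids the open set
  -- `V` around `K ∩ Ici x`.
  have hclK : closure (K ∩ W) ⊆ K := closure_minimal inter_subset_left hK.isClosed
  obtain ⟨a, haW, ha⟩ := exists_isGreatest_of_isCompact (hK.of_isClosed_subset isClosed_closure hclK)
    (supClosed_closure (hsup.inter hWsup)) ⟨z, subset_closure hzW⟩
  have hclV : closure (K ∩ W) ⊆ Vᶜ := closure_minimal
    (fun w hw hwV => disjoint_left.1 hUV (hWU hw.2) hwV) hV.isClosed_compl
  refine ⟨a, hclK haW, ha (subset_closure hzW), fun hxa => hclV haW (hKV ⟨hclK haW, hxa⟩), ?_⟩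
  filter_upwards [self_mem_nhdsWithin, mem_nhdsWithin_of_mem_nhds hWz] with w hwK hwW
  exact ha (subset_closure ⟨hwK, hwW⟩)

/-- Points of a compact convex set are separated by relatively open ideals. -/
lemma LocallyConvex.exists_open_ideal (hS : LocallyConvex S) {K : Set S}
    (hK : IsCompact K) (hsup : SupClosed K) {x z : S} (hz : z ∈ K) (hxz : ¬ x ≤ z) :
    ∃ V : Set S, z ∈ V ∧ x ∉ V ∧ IsLowerSet V ∧ SupClosed V ∧ ∀ y ∈ K ∩ V, V ∈ 𝓝[K] y := by
  choose! f hfK hle hfx hfn using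
    fun (b : S) (hb : b ∈ K ∧ ¬ x ≤ b) => hS.exists_Iic_mem_nhdsWithin hK hsup hb.1 hb.2
  -- `Iic (f b)` is a neighbourhood of `b` but perhaps not of its other points; the union of the
  -- ideals along the iterates is open in `K`.
  let a : ℕ → S := fun n => f^[n] z
  have hsucc (n : ℕ) : a (n + 1) = f (a n) := Function.iterate_succ_apply' f n z
  have ha (n : ℕ) : a n ∈ K ∧ ¬ x ≤ a n := by
    induction n with
    | zero => exact ⟨hz, hxz⟩
    | succ n ih => rw [hsucc]; exact ⟨hfK _ ih, hfx _ ih⟩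
  have hmono : Monotone a := monotone_nat_of_le_succ fun n => hsucc n ▸ hle _ (ha n)
  refine ⟨{y | ∃ n, y ≤ a n}, ⟨0, le_rfl⟩, fun ⟨n, hn⟩ => (ha n).2 hn,
    fun b c hcb ⟨n, hn⟩ => ⟨n, hcb.trans hn⟩, ?_, ?_⟩
  · rintro b ⟨m, hm⟩ c ⟨n, hn⟩
    exact ⟨max m n, sup_le (hm.trans (hmono (le_max_left m n)))
      (hn.trans (hmono (le_max_right m n)))⟩
  · rintro y ⟨-, n, hn⟩
    -- Since `y ⊔ a n = a n`, joining with `a n` pulls the neighbourhood `Iic (a (n + 1))` of `a n`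
    -- back to one of `y`.
    have htend : Filter.Tendsto (· ⊔ a n) (𝓝[K] y) (𝓝[K] (a n)) := by
      refine tendsto_nhdsWithin_iff.2 ⟨?_, ?_⟩
      · have : Continuous (· ⊔ a n : S → S) := by fun_prop
        simpa only [ContinuousWithinAt, sup_eq_right.2 hn] using
          this.continuousWithinAt (s := K) (x := y)
      · filter_upwards [self_mem_nhdsWithin] with w hw using hsup hw (ha n).1
    filter_upwards [htend (hfn _ (ha n))] with w hw
    exact ⟨n + 1, hsucc n ▸ le_sup_left.trans hw⟩

/-- In a compact convex set, `x ≰ z` implies that some extreme point `y` satisfies `y ≰ z`. -/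
lemma LocallyConvex.exists_isExtremePt_not_le (hS : LocallyConvex S) {K : Set S}
    (hK : IsCompact K) (hsup : SupClosed K) {x z : S} (hx : x ∈ K) (hz : z ∈ K)
    (hxz : ¬ x ≤ z) : ∃ y, IsExtremePt K y ∧ ¬ y ≤ z := by
  have := orderClosedTopology_of_continuousSup (S := S)
  obtain ⟨V, hzV, hxV, hlow, hVsup, hVn⟩ := hS.exists_open_ideal hK hsup hz hxz
  have hcl : IsClosed (K \ V) := by
    refine closure_subset_iff_isClosed.1 fun y hy => ?_
    have hyK : y ∈ K := closure_minimal sdiff_subset hK.isClosed hy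
    refine ⟨hyK, fun hyV => ?_⟩
    obtain ⟨U, hU, hUV⟩ := mem_nhdsWithin_iff_exists_mem_nhds_inter.1 (hVn y ⟨hyK, hyV⟩)
    obtain ⟨w, hwU, hwK, hwV⟩ := mem_closure_iff_nhds.1 hy U hU
    exact hwV (hUV ⟨hwU, hwK⟩)
  obtain ⟨y, hy⟩ := exists_minimal_of_isCompact
    (hK.of_isClosed_subset hcl sdiff_subset) ⟨x, hx, hxV⟩
  refine ⟨y, isExtremePt_of_forall_lt hVsup hy.prop.1 hy.prop.2 fun w hw hwy => ?_,
    fun hyz => hy.prop.2 (hlow hyz hzV)⟩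
  by_contra hwV
  exact hy.not_lt ⟨hw, hwV⟩ hwy

/-- The Krein-Milman theorem for compact convex sets with a greatest element. -/
lemma LocallyConvex.mem_closure_supClosure_ex (hS : LocallyConvex S) {K : Set S}
    (hK : IsCompact K) (hsup : SupClosed K) {x : S} (hx : IsGreatest K x) :
    x ∈ closure (supClosure (ex K)) := by
  have hclK : closure (supClosure (ex K)) ⊆ K :=
    closure_minimal (supClosure_min (fun _ hy => hy.1) hsup) hK.isClosed
  obtain ⟨z, hz, hmax⟩ := exists_isGreatest_of_isCompact
    (hK.of_isClosed_subset isClosed_closure hclK) (supClosed_closure supClosed_supClosure)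
    ((ex_nonempty_of_isCompact hK ⟨x, hx.1⟩).mono (subset_supClosure.trans subset_closure))
  by_cases hxz : x ≤ z
  · exact le_antisymm hxz (hx.2 (hclK hz)) ▸ hz
  · obtain ⟨y, hy, hyz⟩ := hS.exists_isExtremePt_not_le hK hsup hx.1 (hclK hz) hxz
    exact (hyz (hmax (subset_closure (subset_supClosure hy)))).elim

lemma LocallyConvex.eq_closure_supClosure_ex (hS : LocallyConvex S) {K : Set S}
    (hK : PrincipallyCompact K) (hcl : IsClosed K) (hsup : SupClosed K) :
    K = closure (supClosure (ex K)) := by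
  refine Subset.antisymm (fun x hx => ?_)
    (closure_minimal (supClosure_min (fun _ hy => hy.1) hsup) hcl)
  refine closure_mono (supClosure_mono fun y hy => IsExtremePt.of_inter_Iic hy)
    (hS.mem_closure_supClosure_ex (hK x hx) (hsup.inter ?_) ⟨⟨hx, le_rfl⟩, fun _ hy => hy.2⟩)
  exact fun _ ha _ hb => sup_le ha hb

lemma principallyCompact_of_isCompact {K : Set S} (hK : IsCompact K) : PrincipallyCompact K := by
  have := orderClosedTopology_of_continuousSup (S := S)
  exact fun _ _ => hK.inter_right isClosed_Iic

end Topological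

end SemilatticeConvexity

theorem mainTheorem2 {S : Type*} [SemilatticeSup S] [TopologicalSpace S] [T2Space S]
    [ContinuousSup S] (hS : SemilatticeConvexity.LocallyConvex S) :
    (∀ K : Set S, K.Nonempty → IsCompact K → (SemilatticeConvexity.ex K).Nonempty) ∧
    (∀ K : Set S, IsCompact K → SupClosed K →
      K = closure (supClosure (SemilatticeConvexity.ex K))) ∧
    (∀ K : Set S, K.Nonempty → SemilatticeConvexity.PrincipallyCompact K →
      (SemilatticeConvexity.ex K).Nonempty) ∧
    (∀ K : Set S, SemilatticeConvexity.PrincipallyCompact K → IsClosed K → SupClosed K →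
      K = closure (supClosure (SemilatticeConvexity.ex K))) :=
  ⟨fun _ hne hK => SemilatticeConvexity.ex_nonempty_of_isCompact hK hne,
    fun _ hK hsup => hS.eq_closure_supClosure_ex
      (SemilatticeConvexity.principallyCompact_of_isCompact hK) hK.isClosed hsup,
    fun _ hne hK => SemilatticeConvexity.ex_nonempty_of_principallyCompact hK hne,
    fun _ hK hcl hsup => hS.eq_closure_supClosure_ex hK hcl hsup⟩
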